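/- Let $k$ be a field, $S=k[x_1,\dots,x_n]$, $\mathfrak m=(x_1,\dots,x_n)$ and $\mathfrak m^{[2]}=(x_1^2,\dots,x_n^2)$. A homogeneous ideal $I$ of a polynomial ring over $k$ that is generated in degree $3$ is called linearly presented if $\operatorname{Tor}_1(I,k)_e=0$ for all $e\neq 4$ (Tor over that polynomial ring); the zero ideal counts as linearly presented. For a subset $K$ of the variables, the restriction $I_K\subset k[K]$ is the image of $I$ under the map $S\to k[K]$ that sets the variables not in $K$ to zero. Let $I\subset S$ be an $\mathfrak m$-primary monomial ideal generated in degree $3$. Then $I$ is linearly presented if and only if the following two conditions hold: 1. $I$ contains $\mathfrak m^{[2]}\mathfrak m$ (in other words, $I$ contains all non-square-free monomials of degree $3$); 2. for any four distinct variables, the restriction of $I$ to these variables contains either at least two square-free monomials of degree $3$ or none. Consequently, $I$ is linearly presented if and only if its restriction to every set of at most four variables is linearly presented; and if $n\geq 4$, it is linearly presented if and only if its restriction to every set of exactly four variables is linearly presented. -/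

import Mathlib

noncomputable section

namespace LinPres

open MvPolynomial

/-- The homogeneous maximal ideal `𝔪 = (x_i : i ∈ σ)` of `S = k[x_i : i ∈ σ]`. -/
def maxIdeal (σ k : Type*) [Field k] : Ideal (MvPolynomial σ k) :=
  Ideal.span (Set.range X)

/-- The ideal `𝔪^[t] = (x_i ^ t : i ∈ σ)`. -/
def maxIdealBracket (σ k : Type*) [Field k] (t : ℕ) : Ideal (MvPolynomial σ k) :=
  Ideal.span (Set.range fun i => X i ^ t)

/-- `I` is a monomial ideal: it is generated by a set of monomials. -/
def IsMonomialIdeal {σ k : Type*} [Field k] (I : Ideal (MvPolynomial σ k)) : Prop :=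
  ∃ A : Set (σ →₀ ℕ), I = Ideal.span ((fun a => monomial a (1 : k)) '' A)

/-- `I` is generated in degree `d`: it is generated by homogeneous elements of degree `d`. -/
def IsGeneratedInDegree {σ k : Type*} [Field k] (d : ℕ) (I : Ideal (MvPolynomial σ k)) : Prop :=
  I = Ideal.span {f | f ∈ I ∧ f.IsHomogeneous d}

/-- `I` is `𝔪`-primary. -/
def IsMaxPrimary {σ k : Type*} [Field k] (I : Ideal (MvPolynomial σ k)) : Prop :=
  I.IsPrimary ∧ I.radical = maxIdeal σ k

/-- The restriction `I_K`: the ideal of `k[x_i : i ∈ K]` that is the image of `I` under the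
surjection `k[x_i : i ∈ σ] → k[x_i : i ∈ K]` setting all the variables outside `K` to zero. -/
def restrict {σ k : Type*} [Field k] (I : Ideal (MvPolynomial σ k)) (K : Finset σ) :
    Ideal (MvPolynomial K k) :=
  I.map (killCompl (R := k) (Subtype.val_injective : Function.Injective (Subtype.val : K → σ)))

/-- The set of square-free monomials of degree `3` contained in `I`. -/
def squareFreeCubics {σ k : Type*} [Field k] (I : Ideal (MvPolynomial σ k)) :
    Set (MvPolynomial σ k) :=
  {f | f ∈ I ∧ ∃ T : Finset σ, T.card = 3 ∧ f = ∏ i ∈ T, X i}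

/-! ### Graded Tor

`Tor_s^S(I, k)` is the homology of `I ⊗_S K`, where `K` is the Koszul complex on the variables,
that is, the graded free resolution of `k = S / 𝔪` with `K_s = ⋀^s (S(-1)^σ)`. A chain
`∑_T c_T e_T`, where `T` runs over the finite sets of variables, is given by its coefficient
function `c`. The basis element `e_T` has degree `T.card`. -/

section Koszul

variable {σ k : Type*} [Fintype σ] [LinearOrder σ] [Field k]

/-- The Koszul differential, sending `c e_U` to `∑_{j ∈ U} (-1)^{#{i ∈ U | i < j}} x_j c e_{U \ j}`:
the coefficient of `e_T` in the image of `∑_U c_U e_U` comes from the sets `U = T ∪ {j}`, with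
`j ∉ T`. -/
def koszulD : (Finset σ → MvPolynomial σ k) →ₗ[k] (Finset σ → MvPolynomial σ k) where
  toFun c T := ∑ j ∈ Tᶜ, (-1) ^ (T.filter (· < j)).card * (X j * c (insert j T))
  map_add' c c' := by
    funext T
    simp only [Pi.add_apply, mul_add, Finset.sum_add_distrib]
  map_smul' r c := by
    funext T
    simp only [Pi.smul_apply, RingHom.id_apply, mul_smul_comm, Finset.smul_sum]

/-- The differential squares to zero. -/
theorem koszulD_koszulD (c : Finset σ → MvPolynomial σ k) : koszulD (koszulD c) = 0 := by
  funext T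
  simp only [koszulD, LinearMap.coe_mk, AddHom.coe_mk, Pi.zero_apply, Finset.mul_sum]
  rw [Finset.sum_sigma']
  refine Finset.sum_involution (fun p _ => ⟨p.2, p.1⟩) ?_ ?_ ?_ ?_
  · rintro ⟨i, j⟩ h
    simp only [Finset.mem_sigma, Finset.mem_compl, Finset.mem_insert, not_or] at h
    obtain ⟨hi, hji, hj⟩ := h
    dsimp only
    rw [Finset.insert_comm j i T, Finset.filter_insert, Finset.filter_insert]
    rcases lt_or_gt_of_ne hji with hlt | hlt
    · rw [if_neg (not_lt.2 hlt.le), if_pos hlt, Finset.card_insert_of_notMem (by simp [hj])]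
      ring
    · rw [if_pos hlt, if_neg (not_lt.2 hlt.le), Finset.card_insert_of_notMem (by simp [hi])]
      ring
  · rintro ⟨i, j⟩ h _ he
    simp only [Finset.mem_sigma, Finset.mem_compl, Finset.mem_insert, not_or] at h
    simp only [Sigma.mk.injEq] at he
    exact h.2.1 he.1
  · rintro ⟨i, j⟩ h
    simp only [Finset.mem_sigma, Finset.mem_compl, Finset.mem_insert, not_or] at h ⊢
    exact ⟨h.2.2, fun e => h.2.1 e.symm, h.1⟩
  · rintro ⟨i, j⟩ _
    rfl

/-- The degree `e` part of `I ⊗ K_s`: the coefficients lie in `I`, only the `e_T` with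
`T.card = s` occur, and the coefficient of such an `e_T` is homogeneous of degree `e - s`
(hence zero if `e < s`). -/
def koszulChains (I : Ideal (MvPolynomial σ k)) (s e : ℕ) :
    Submodule k (Finset σ → MvPolynomial σ k) where
  carrier := {c | ∀ T, c T ∈ I ∧ (T.card ≠ s → c T = 0) ∧
    ∀ u, coeff u (c T) ≠ 0 → u.degree + s = e}
  zero_mem' T := by simp
  add_mem' {c c'} h h' T := by
    refine ⟨I.add_mem (h T).1 (h' T).1, fun hT => ?_, fun u hu => ?_⟩
    · rw [Pi.add_apply, (h T).2.1 hT, (h' T).2.1 hT, add_zero]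
    · by_cases h0 : coeff u (c T) = 0
      · refine (h' T).2.2 u fun h1 => hu ?_
        rw [Pi.add_apply, coeff_add, h0, h1, add_zero]
      · exact (h T).2.2 u h0
  smul_mem' r c h T := by
    refine ⟨?_, fun hT => ?_, fun u hu => ?_⟩
    · rw [Pi.smul_apply, smul_eq_C_mul]
      exact I.mul_mem_left _ (h T).1
    · rw [Pi.smul_apply, (h T).2.1 hT, smul_zero]
    · refine (h T).2.2 u fun h1 => hu ?_
      rw [Pi.smul_apply, coeff_smul, h1, smul_zero]

/-- The cycles of `I ⊗ K` in homological degree `s` and internal degree `e`. -/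
def koszulCycles (I : Ideal (MvPolynomial σ k)) (s e : ℕ) :
    Submodule k (Finset σ → MvPolynomial σ k) :=
  koszulChains I s e ⊓ LinearMap.ker koszulD

/-- The boundaries of `I ⊗ K` in homological degree `s` and internal degree `e`. -/
def koszulBoundaries (I : Ideal (MvPolynomial σ k)) (s e : ℕ) :
    Submodule k (Finset σ → MvPolynomial σ k) :=
  (koszulChains I (s + 1) e).map koszulD

/-- The degree `e` part `Tor_s^S(I, k)_e`: cycles modulo boundaries. -/
abbrev gradedTor (I : Ideal (MvPolynomial σ k)) (s e : ℕ) : Type _ :=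
  koszulCycles I s e ⧸ (koszulBoundaries I s e).submoduleOf (koszulCycles I s e)

/-- The condition `N_{d,p}`: for all `s < p`, the graded vector space `Tor_s^S(I, k)` is
concentrated in degree `d + s`. Thus `N_{d,1}` says that `I` is generated in degree `d`, and
`N_{d,p}` that its resolution is moreover linear for `p - 1` steps. Zero Tor is allowed. -/
def SatisfiesN (d p : ℕ) (I : Ideal (MvPolynomial σ k)) : Prop :=
  ∀ s < p, ∀ e : ℕ, Nontrivial (gradedTor I s e) → e = d + s

/-- `I` is generated in degree `d` and linearly presented. -/
def IsLinearlyPresented (d : ℕ) (I : Ideal (MvPolynomial σ k)) : Prop :=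
  SatisfiesN d 2 I

end Koszul

end LinPres

end

/-! Let `A` be the set of exponents of the monomials in `I`. The Koszul complex is graded by
multidegrees, and `Tor_1` in multidegree `a` is the reduced `H_0` of a graph: its vertices are the
variables `x_i` with `x^a / x_i` in `I`, its edges the pairs with `x^a / (x_i x_j)` in `I`. Linear
presentation thus means that these graphs are connected (or empty) whenever `a` has degree other
than `4`.

If the two conditions hold, each cubic of `I` dividing `x^a` gives a clique, and the exchange
property links any two such cliques once `a` has degree at least `5` (`vertices_related`). Hence
cycles are boundaries (`cycles_one_le_boundaries`). If a condition fails, some multidegree of degree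
`5` or `6` has an isolated vertex next to another vertex, which yields a nonzero class
(`not_cycles_one_le_boundaries`).

`isLinearlyPresented_iff` needs only that `I` contains the cubes of the variables, a property
inherited by restrictions. Both conditions involve at most four variables at a time, so they can be
tested on restrictions. -/

namespace LinPres

open MvPolynomial

/-! ### Combinatorics of exponents: connectivity of the graphs -/

section Exponents

variable {σ : Type*}

/-- The exponent vector of the variable `x_i`. -/
noncomputable abbrev unitExp (i : σ) : σ →₀ ℕ := Finsupp.single i 1

/-- A set of exponent vectors that is an up-set generated by vectors of degree `3`. -/
structure IsCubicUpperSet (A : Set (σ →₀ ℕ)) : Prop where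
  upper : IsUpperSet A
  exists_le : ∀ u ∈ A, ∃ v ∈ A, v ≤ u ∧ v.degree = 3

/-- `A` contains the exponents of all the monomials `x_i ^ 2 * x_j`. -/
def ContainsNonSquareFree (A : Set (σ →₀ ℕ)) : Prop :=
  ∀ i j, unitExp i + unitExp i + unitExp j ∈ A

/-- Among the square-free cubics in four given variables, `A` contains none or at least two. -/
def FourVariableExchange (A : Set (σ →₀ ℕ)) : Prop :=
  ∀ i j l m, i ≠ j → i ≠ l → j ≠ l → m ≠ i → m ≠ j → m ≠ l →
    unitExp i + unitExp j + unitExp l ∈ A →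
      unitExp i + unitExp j + unitExp m ∈ A ∨ unitExp i + unitExp l + unitExp m ∈ A ∨
        unitExp j + unitExp l + unitExp m ∈ A

theorem exists_eq_add_unitExp {u : σ →₀ ℕ} {n : ℕ} (hu : u.degree = n + 1) :
    ∃ i v, u = v + unitExp i ∧ v.degree = n := by
  have hne : u ≠ 0 := by
    rintro rfl
    simp at hu
  obtain ⟨i, hi⟩ := Finsupp.ne_iff.1 hne
  have hle : unitExp i ≤ u := by
    rw [Finsupp.single_le_iff]
    exact Nat.one_le_iff_ne_zero.2 hi
  refine ⟨i, u - unitExp i, (tsub_add_cancel_of_le hle).symm, ?_⟩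
  have h := congrArg Finsupp.degree (tsub_add_cancel_of_le hle)
  rw [map_add, Finsupp.degree_single] at h
  omega

theorem eq_zero_of_degree {u : σ →₀ ℕ} (hu : u.degree = 0) : u = 0 :=
  (Finsupp.degree_eq_zero_iff u).1 hu

theorem exists_eq_of_degree_one {u : σ →₀ ℕ} (hu : u.degree = 1) : ∃ i, u = unitExp i := by
  obtain ⟨i, v, rfl, hv⟩ := exists_eq_add_unitExp hu
  exact ⟨i, by rw [eq_zero_of_degree hv, zero_add]⟩

theorem exists_eq_of_degree_two {u : σ →₀ ℕ} (hu : u.degree = 2) :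
    ∃ i j, u = unitExp i + unitExp j := by
  obtain ⟨j, v, rfl, hv⟩ := exists_eq_add_unitExp hu
  obtain ⟨i, rfl⟩ := exists_eq_of_degree_one hv
  exact ⟨i, j, rfl⟩

theorem exists_eq_of_degree_three {u : σ →₀ ℕ} (hu : u.degree = 3) :
    ∃ i j l, u = unitExp i + unitExp j + unitExp l := by
  obtain ⟨l, v, rfl, hv⟩ := exists_eq_add_unitExp hu
  obtain ⟨i, j, rfl⟩ := exists_eq_of_degree_two hv
  exact ⟨i, j, l, rfl⟩

/-- If two of the four variables coincide, one of the alternatives is a non-square-free cubic. Later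
arguments can thus ignore coincidences among variables. -/
theorem FourVariableExchange.exchange {A : Set (σ →₀ ℕ)} (h1 : ContainsNonSquareFree A)
    (h2 : FourVariableExchange A) (i j l m : σ)
    (h : unitExp i + unitExp j + unitExp l ∈ A) :
    unitExp i + unitExp j + unitExp m ∈ A ∨ unitExp i + unitExp l + unitExp m ∈ A ∨
      unitExp j + unitExp l + unitExp m ∈ A := by
  by_cases hij : i = j
  · subst hij
    exact .inl (h1 i m)
  by_cases hil : i = l
  · subst hil
    exact .inr (.inl (h1 i m))
  by_cases hjl : j = l
  · subst hjl
    exact .inr (.inr (h1 j m))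
  by_cases hmi : m = i
  · subst hmi
    refine .inl ?_
    rw [add_right_comm]
    exact h1 m j
  by_cases hmj : m = j
  · subst hmj
    refine .inl ?_
    rw [add_assoc, add_comm]
    exact h1 m i
  by_cases hml : m = l
  · subst hml
    refine .inr (.inl ?_)
    rw [add_assoc, add_comm]
    exact h1 m i
  exact h2 i j l m hij hil hjl hmi hmj hml h

/-- The upper Koszul simplicial complex of `A` in a multidegree `a` of degree at least `5` is
connected: every equivalence relation that relates the ends of its edges relates all its
vertices. -/
theorem vertices_related {A : Set (σ →₀ ℕ)} (hA : IsCubicUpperSet A)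
    (h1 : ContainsNonSquareFree A) (h2 : FourVariableExchange A) {a : σ →₀ ℕ}
    (ha : 5 ≤ a.degree) {r : σ → σ → Prop} (hr : Equivalence r)
    (hedge : ∀ i j w, w ∈ A → w + unitExp i + unitExp j = a → r i j)
    {i j : σ} {v v' : σ →₀ ℕ} (hv : v ∈ A) (hv' : v' ∈ A) (hi : v + unitExp i = a)
    (hj : v' + unitExp j = a) : r i j := by
  -- The variables still available after dividing `x^a` by `x^t` form a clique: two distinct ones
  -- are available simultaneously.
  have key : ∀ t ∈ A, ∀ p q, t + unitExp p ≤ a → t + unitExp q ≤ a → r p q := by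
    intro t ht p q hp hq
    by_cases hpq : p = q
    · subst hpq
      exact hr.refl p
    have hle : t + unitExp p + unitExp q ≤ a := by
      classical
      intro x
      have hpx := hp x
      have hqx := hq x
      simp only [Finsupp.add_apply, Finsupp.single_apply] at hpx hqx ⊢
      by_cases h : p = x
      · have : q ≠ x := fun h' => hpq (h.trans h'.symm)
        simpa [this] using hpx
      · simpa [h] using hqx
    obtain ⟨c, rfl⟩ := exists_add_of_le hle
    exact hedge p q (t + c) (hA.upper le_self_add ht) (by abel)
  obtain ⟨t, ht, htv, htd⟩ := hA.exists_le v hv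
  obtain ⟨t', ht', htv', htd'⟩ := hA.exists_le v' hv'
  have hti : t + unitExp i ≤ a := hi ▸ add_le_add_left htv _
  have htj : t' + unitExp j ≤ a := hj ▸ add_le_add_left htv' _
  suffices h : ∃ p q, t + unitExp p ≤ a ∧ t' + unitExp q ≤ a ∧ r p q by
    obtain ⟨p, q, hp, hq, hpq⟩ := h
    exact hr.trans (key t ht i p hti hp) (hr.trans hpq (key t' ht' q j hq htj))
  by_cases hc : ∃ p, t + unitExp p ≤ a ∧ t' + unitExp p ≤ a
  · obtain ⟨p, hp, hp'⟩ := hc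
    exact ⟨p, p, hp, hp', hr.refl p⟩
  -- With no common vertex in the two cliques, `t` or `t'` exhausts `a` at each variable. So `a` is
  -- their lcm, and the gcd has degree `6 - a.degree ≤ 1`.
  have hsup : t ⊔ t' = a := by
    have hta : t ≤ a := le_self_add.trans hti
    have hta' : t' ≤ a := le_self_add.trans htj
    refine le_antisymm (sup_le hta hta') fun p => ?_
    by_contra hlt
    rw [Finsupp.sup_apply, not_le, sup_lt_iff] at hlt
    classical
    refine hc ⟨p, ?_, ?_⟩
    · intro x
      have := hta x
      by_cases hx : p = x
      · subst hx
        simpa using hlt.1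
      · simpa [Finsupp.single_apply, hx] using this
    · intro x
      have := hta' x
      by_cases hx : p = x
      · subst hx
        simpa using hlt.2
      · simpa [Finsupp.single_apply, hx] using this
  obtain ⟨u, hu⟩ := exists_add_of_le (inf_le_left : t ⊓ t' ≤ t)
  obtain ⟨u', hu'⟩ := exists_add_of_le (inf_le_right : t ⊓ t' ≤ t')
  have hadd : t ⊓ t' + a = t + t' := by
    rw [← hsup]
    ext x
    simp only [Finsupp.add_apply, Finsupp.inf_apply, Finsupp.sup_apply]
    exact min_add_max _ _
  generalize t ⊓ t' = g at hu hu' hadd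
  have hau : a = g + u + u' := by
    refine add_left_cancel (a := g) ?_
    rw [hadd]
    conv_lhs => rw [hu, hu']
    abel
  have hd := congrArg Finsupp.degree hu
  have hd' := congrArg Finsupp.degree hu'
  have hda := congrArg Finsupp.degree hau
  simp only [map_add] at hd hd' hda
  have hle {x y : σ →₀ ℕ} (c : σ →₀ ℕ) (h : x + c = y) : x ≤ y := h ▸ le_self_add
  obtain hg | hg : g.degree = 0 ∨ g.degree = 1 := by omega
  · obtain ⟨i₁, i₂, i₃, rfl⟩ := exists_eq_of_degree_three htd
    obtain ⟨i₄, i₅, i₆, rfl⟩ := exists_eq_of_degree_three htd'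
    obtain rfl := eq_zero_of_degree hg
    rw [zero_add] at hu hu' hau
    subst hu hu' hau
    -- Coprime case: the clique of the exchanged cubic contains `i₅`, a vertex for `t`, and the
    -- dropped factor of `t`, a vertex for `t'`.
    rcases FourVariableExchange.exchange h1 h2 i₁ i₂ i₃ i₄ ht with h | h | h
    · exact ⟨i₅, i₃, hle (unitExp i₄ + unitExp i₆) (by abel),
        hle (unitExp i₁ + unitExp i₂) (by abel),
        key _ h _ _ (hle (unitExp i₃ + unitExp i₆) (by abel))
          (hle (unitExp i₅ + unitExp i₆) (by abel))⟩
    · exact ⟨i₅, i₂, hle (unitExp i₄ + unitExp i₆) (by abel),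
        hle (unitExp i₁ + unitExp i₃) (by abel),
        key _ h _ _ (hle (unitExp i₂ + unitExp i₆) (by abel))
          (hle (unitExp i₅ + unitExp i₆) (by abel))⟩
    · exact ⟨i₅, i₁, hle (unitExp i₄ + unitExp i₆) (by abel),
        hle (unitExp i₂ + unitExp i₃) (by abel),
        key _ h _ _ (hle (unitExp i₁ + unitExp i₆) (by abel))
          (hle (unitExp i₅ + unitExp i₆) (by abel))⟩
  · obtain ⟨i₁, i₂, rfl⟩ := exists_eq_of_degree_two (u := u) (by omega)
    obtain ⟨i₄, i₅, rfl⟩ := exists_eq_of_degree_two (u := u') (by omega)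
    obtain ⟨i₃, rfl⟩ := exists_eq_of_degree_one hg
    subst hu hu' hau
    have htA : unitExp i₁ + unitExp i₂ + unitExp i₃ ∈ A := by
      convert ht using 1
      abel
    have htA' : unitExp i₄ + unitExp i₅ + unitExp i₃ ∈ A := by
      convert ht' using 1
      abel
    have hp₄ : unitExp i₃ + (unitExp i₁ + unitExp i₂) + unitExp i₄ ≤
        unitExp i₃ + (unitExp i₁ + unitExp i₂) + (unitExp i₄ + unitExp i₅) :=
      hle (unitExp i₅) (by abel)
    have hp₅ : unitExp i₃ + (unitExp i₁ + unitExp i₂) + unitExp i₅ ≤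
        unitExp i₃ + (unitExp i₁ + unitExp i₂) + (unitExp i₄ + unitExp i₅) :=
      hle (unitExp i₄) (by abel)
    have hq₁ : unitExp i₃ + (unitExp i₄ + unitExp i₅) + unitExp i₁ ≤
        unitExp i₃ + (unitExp i₁ + unitExp i₂) + (unitExp i₄ + unitExp i₅) :=
      hle (unitExp i₂) (by abel)
    have hq₂ : unitExp i₃ + (unitExp i₄ + unitExp i₅) + unitExp i₂ ≤
        unitExp i₃ + (unitExp i₁ + unitExp i₂) + (unitExp i₄ + unitExp i₅) :=
      hle (unitExp i₁) (by abel)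
    -- The vertices for `t` include `i₄, i₅`, those for `t'` include `i₁, i₂`. If the exchange drops
    -- the shared variable `i₃`, it only links `i₅` to `i₃`, and a second exchange, of `t'` with
    -- `i₁`, is needed.
    rcases FourVariableExchange.exchange h1 h2 i₁ i₂ i₃ i₄ htA with h | h | h
    · have h53 : r i₅ i₃ := key _ h _ _ (hle (unitExp i₃) (by abel)) (hle (unitExp i₅) (by abel))
      rcases FourVariableExchange.exchange h1 h2 i₄ i₅ i₃ i₁ htA' with h | h | h
      · have h32 : r i₃ i₂ := key _ h _ _ (hle (unitExp i₂) (by abel)) (hle (unitExp i₃) (by abel))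
        exact ⟨i₅, i₂, hp₅, hq₂, hr.trans h53 h32⟩
      · exact ⟨i₅, i₂, hp₅, hq₂,
          key _ h _ _ (hle (unitExp i₂) (by abel)) (hle (unitExp i₅) (by abel))⟩
      · exact ⟨i₄, i₂, hp₄, hq₂,
          key _ h _ _ (hle (unitExp i₂) (by abel)) (hle (unitExp i₄) (by abel))⟩
    · exact ⟨i₅, i₂, hp₅, hq₂,
        key _ h _ _ (hle (unitExp i₂) (by abel)) (hle (unitExp i₅) (by abel))⟩
    · exact ⟨i₅, i₁, hp₅, hq₁,
        key _ h _ _ (hle (unitExp i₁) (by abel)) (hle (unitExp i₅) (by abel))⟩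

end Exponents

/-! ### Cycles and boundaries of the Koszul complex -/

section KoszulHomology

variable {σ k : Type*} [Field k]

/-- `I` is the ideal spanned by the monomials with exponent in `A`, where `A` is an up-set
generated in degree `3`. -/
structure IsCubicMonomial (I : Ideal (MvPolynomial σ k)) (A : Set (σ →₀ ℕ)) : Prop
    extends IsCubicUpperSet A where
  mem_iff : ∀ f, f ∈ I ↔ ∀ u ∈ f.support, u ∈ A

theorem IsCubicMonomial.monomial_mem {I : Ideal (MvPolynomial σ k)} {A : Set (σ →₀ ℕ)}
    (hI : IsCubicMonomial I A) {u : σ →₀ ℕ} (hu : u ∈ A) (c : k) : monomial u c ∈ I := by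
  rw [hI.mem_iff]
  intro v hv
  rw [Finset.mem_singleton.1 (support_monomial_subset hv)]
  exact hu

theorem IsCubicMonomial.mem_of_coeff {I : Ideal (MvPolynomial σ k)} {A : Set (σ →₀ ℕ)}
    (hI : IsCubicMonomial I A) {f : MvPolynomial σ k} (hf : f ∈ I) {u : σ →₀ ℕ}
    (hu : coeff u f ≠ 0) : u ∈ A :=
  (hI.mem_iff f).1 hf u (mem_support_iff.2 hu)

theorem IsCubicMonomial.mem_of_monomial_mem {I : Ideal (MvPolynomial σ k)}
    {A : Set (σ →₀ ℕ)} (hI : IsCubicMonomial I A) {u : σ →₀ ℕ}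
    (hu : monomial u (1 : k) ∈ I) : u ∈ A := by
  classical
  exact hI.mem_of_coeff hu (by rw [coeff_monomial, if_pos rfl]; exact one_ne_zero)

theorem IsCubicMonomial.three_le_degree {I : Ideal (MvPolynomial σ k)} {A : Set (σ →₀ ℕ)}
    (hI : IsCubicMonomial I A) {u : σ →₀ ℕ} (hu : u ∈ A) : 3 ≤ u.degree := by
  obtain ⟨v, -, hvu, hv⟩ := hI.exists_le u hu
  exact hv ▸ Finsupp.degree_mono hvu

theorem monomial_add_unitExp (w : σ →₀ ℕ) (i : σ) (c : k) :
    monomial (w + unitExp i) c = X i * monomial w c := by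
  rw [X, monomial_mul, one_mul, add_comm]

section Chains

variable [DecidableEq σ]

/-- The chain `f e_T`. -/
noncomputable def chain (T : Finset σ) (f : MvPolynomial σ k) : Finset σ → MvPolynomial σ k :=
  Pi.single T f

theorem chain_same (T : Finset σ) (f : MvPolynomial σ k) : chain T f T = f :=
  Pi.single_eq_same _ _

theorem chain_ne {T T' : Finset σ} (h : T' ≠ T) (f : MvPolynomial σ k) : chain T f T' = 0 :=
  Pi.single_eq_of_ne h _

theorem chain_sum {ι : Type*} (T : Finset σ) (s : Finset ι) (f : ι → MvPolynomial σ k) :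
    chain T (∑ i ∈ s, f i) = ∑ i ∈ s, chain T (f i) :=
  map_sum (LinearMap.single k (fun _ : Finset σ => MvPolynomial σ k) T) f s

theorem chain_smul (T : Finset σ) (r : k) (f : MvPolynomial σ k) :
    chain T (r • f) = r • chain T f :=
  map_smul (LinearMap.single k (fun _ : Finset σ => MvPolynomial σ k) T) r f

end Chains

variable [LinearOrder σ]

theorem chain_mem_koszulChains {I : Ideal (MvPolynomial σ k)} {A : Set (σ →₀ ℕ)}
    (hI : IsCubicMonomial I A) {u : σ →₀ ℕ} (hu : u ∈ A) (c : k) {T : Finset σ} {s e : ℕ}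
    (hT : T.card = s) (he : u.degree + s = e) :
    chain T (monomial u c) ∈ koszulChains I s e := by
  intro T'
  by_cases h : T' = T
  · subst h
    rw [chain_same]
    refine ⟨hI.monomial_mem hu c, fun h => absurd hT h, fun v hv => ?_⟩
    rw [coeff_monomial] at hv
    obtain rfl : u = v := by
      by_contra h
      rw [if_neg h] at hv
      exact hv rfl
    exact he
  · rw [chain_ne h]
    simp

variable [Fintype σ]

theorem nontrivial_gradedTor_iff (I : Ideal (MvPolynomial σ k)) (s e : ℕ) :
    Nontrivial (gradedTor I s e) ↔ ¬ koszulCycles I s e ≤ koszulBoundaries I s e := by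
  rw [Submodule.Quotient.nontrivial_iff, Ne, Submodule.submoduleOf_eq_top]

theorem koszulD_apply (c : Finset σ → MvPolynomial σ k) (T : Finset σ) :
    koszulD c T = ∑ j ∈ Tᶜ, (-1) ^ (T.filter (· < j)).card * (X j * c (insert j T)) :=
  rfl

theorem koszulD_apply_empty (c : Finset σ → MvPolynomial σ k) :
    koszulD c ∅ = ∑ j, X j * c {j} := by
  simp [koszulD_apply]

theorem koszulD_chain_singleton (j : σ) (f : MvPolynomial σ k) :
    koszulD (chain {j} f) = chain ∅ (X j * f) := by
  funext T
  rcases T.eq_empty_or_nonempty with rfl | ⟨i, hi⟩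
  · rw [koszulD_apply_empty, chain_same, Finset.sum_eq_single j]
    · simp [chain_same]
    · intro l _ hl
      rw [chain_ne (by simpa using hl), mul_zero]
    · simp
  · rw [chain_ne (Finset.nonempty_iff_ne_empty.1 ⟨i, hi⟩), koszulD_apply]
    refine Finset.sum_eq_zero fun l hl => ?_
    rw [chain_ne, mul_zero, mul_zero]
    intro h
    have h1 : l = j := by simpa [h] using Finset.mem_insert_self l T
    have h2 : i = j := by simpa [h] using Finset.mem_insert_of_mem (b := l) hi
    rw [Finset.mem_compl, h1, ← h2] at hl
    exact hl hi

theorem koszulD_chain_pair {i j : σ} (hij : i < j) (f : MvPolynomial σ k) :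
    koszulD (chain {i, j} f) = chain {j} (X i * f) - chain {i} (X j * f) := by
  have hne : ({i} : Finset σ) ≠ {j} := by simpa using hij.ne
  funext T
  rw [koszulD_apply, Pi.sub_apply]
  by_cases hTi : T = {i}
  · subst hTi
    rw [chain_ne hne, chain_same, Finset.sum_eq_single j]
    · rw [Finset.pair_comm j i, chain_same]
      simp [Finset.filter_singleton, hij]
    · intro l hl hlj
      rw [chain_ne, mul_zero, mul_zero]
      intro h
      have := h.le <| Finset.mem_insert_self l {i}
      simp_all
    · simp [hij.ne']
  by_cases hTj : T = {j}
  · subst hTj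
    rw [chain_ne hTi, chain_same, Finset.sum_eq_single i]
    · rw [chain_same]
      simp [Finset.filter_singleton, hij.not_gt]
    · intro l hl hlj
      rw [chain_ne, mul_zero, mul_zero]
      intro h
      have := h.le <| Finset.mem_insert_self l {j}
      simp_all
    · simp [hij.ne]
  rw [chain_ne hTi, chain_ne hTj, sub_zero]
  refine Finset.sum_eq_zero fun l hl => ?_
  rw [chain_ne, mul_zero, mul_zero]
  intro h
  rw [Finset.mem_compl] at hl
  have hT : T = ({i, j} : Finset σ).erase l := by rw [← h, Finset.erase_insert hl]
  have hl' : l = i ∨ l = j := by simpa [h] using Finset.mem_insert_self l T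
  rcases hl' with rfl | rfl
  · exact hTj (by rw [hT, Finset.erase_insert (by simpa using hij.ne)])
  · exact hTi (by rw [hT, Finset.pair_comm, Finset.erase_insert (by simpa using hij.ne')])

/-- An edge of the graph makes its two ends homologous. -/
theorem chain_sub_chain_mem_koszulBoundaries {I : Ideal (MvPolynomial σ k)}
    {A : Set (σ →₀ ℕ)} (hI : IsCubicMonomial I A) {w : σ →₀ ℕ} (hw : w ∈ A) (c : k) {e : ℕ}
    (he : w.degree + 2 = e) {i j : σ} (hij : i ≠ j) :
    (chain {j} (monomial (w + unitExp i) c) - chain {i} (monomial (w + unitExp j) c)) ∈ koszulBoundaries I 1 e := by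
  wlog hlt : i < j generalizing i j
  · rw [← neg_sub]
    exact neg_mem (this hij.symm (lt_of_le_of_ne (not_lt.1 hlt) hij.symm))
  rw [monomial_add_unitExp, monomial_add_unitExp, ← koszulD_chain_pair hlt]
  exact Submodule.mem_map_of_mem
    (chain_mem_koszulChains hI hw c (Finset.card_pair hij) he)

/-- A monomial of `I` that is not a cubic is a variable times another monomial of `I`. -/
theorem cycles_zero_le_boundaries {I : Ideal (MvPolynomial σ k)} {A : Set (σ →₀ ℕ)}
    (hI : IsCubicMonomial I A) {e : ℕ} (he : e ≠ 3) :
    koszulCycles I 0 e ≤ koszulBoundaries I 0 e := by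
  rintro c ⟨hc, -⟩
  have hc0 : c = chain ∅ (c ∅) := by
    funext T
    by_cases hT : T = ∅
    · subst hT
      rw [chain_same]
    · rw [chain_ne hT]
      exact (hc T).2.1 (by simpa using hT)
  rw [hc0, (c ∅).as_sum, chain_sum]
  refine sum_mem fun u hu => ?_
  have hu0 := mem_support_iff.1 hu
  have huA := hI.mem_of_coeff (hc ∅).1 hu0
  have hue := (hc ∅).2.2 u hu0
  obtain ⟨v, hv, hvu, hvd⟩ := hI.exists_le u huA
  obtain ⟨w, rfl⟩ := exists_add_of_le hvu
  rw [map_add] at hue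
  obtain ⟨i, w', rfl, -⟩ := exists_eq_add_unitExp (u := w) (n := w.degree - 1) (by omega)
  rw [map_add, Finsupp.degree_single] at hue
  rw [← add_assoc, monomial_add_unitExp, ← koszulD_chain_singleton]
  refine Submodule.mem_map_of_mem
    (chain_mem_koszulChains hI (hI.upper le_self_add hv) _ (Finset.card_singleton i) ?_)
  rw [map_add]
  omega

/-- By connectivity, the class of a vertex modulo boundaries depends only on the multidegree. So the
class of a chain `c` is a linear function `Φ` of `∑ x_j c_j`, its differential, and vanishes on
cycles. -/
theorem cycles_one_le_boundaries {I : Ideal (MvPolynomial σ k)} {A : Set (σ →₀ ℕ)}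
    (hI : IsCubicMonomial I A) (h1 : ContainsNonSquareFree A) (h2 : FourVariableExchange A)
    {e : ℕ} (he : e ≠ 4) : koszulCycles I 1 e ≤ koszulBoundaries I 1 e := by
  classical
  rintro c ⟨hc, hcyc⟩
  let B := koszulBoundaries I 1 e
  let F (a : σ →₀ ℕ) (i : σ) : (Finset σ → MvPolynomial σ k) ⧸ B :=
    B.mkQ (chain {i} (monomial (a - unitExp i) 1))
  have hF (i : σ) (v : σ →₀ ℕ) : F (v + unitExp i) i = B.mkQ (chain {i} (monomial v 1)) := by
    simp only [F, add_tsub_cancel_right]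
  let V (a : σ →₀ ℕ) (i : σ) : Prop := ∃ v ∈ A, v + unitExp i = a
  -- The class of an arbitrarily chosen vertex; the value `0` is used only in multidegrees without
  -- vertices.
  let R (a : σ →₀ ℕ) : (Finset σ → MvPolynomial σ k) ⧸ B :=
    if h : ∃ i, V a i then F a h.choose else 0
  let Φ : MvPolynomial σ k →ₗ[k] (Finset σ → MvPolynomial σ k) ⧸ B :=
    (basisMonomials σ k).constr k R
  have hΦ (a : σ →₀ ℕ) (r : k) : Φ (monomial a r) = r • R a := by
    have := (basisMonomials σ k).constr_basis k R a
    rw [coe_basisMonomials] at this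
    rw [← this, ← map_smul, smul_monomial, smul_eq_mul, mul_one]
  have hR (i : σ) (v : σ →₀ ℕ) (hv : v ∈ A) (hd : v.degree + 1 = e) :
      B.mkQ (chain {i} (monomial v 1)) = R (v + unitExp i) := by
    have hex : ∃ j, V (v + unitExp i) j := ⟨i, v, hv, rfl⟩
    have hR' : R (v + unitExp i) = F (v + unitExp i) hex.choose := dif_pos hex
    obtain ⟨v', hv', hj⟩ := hex.choose_spec
    rw [hR', ← hF]
    have hdeg : (v + unitExp i).degree = e := by
      rw [map_add, Finsupp.degree_single, hd]
    have hdeg' : 5 ≤ (v + unitExp i).degree := by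
      have := hI.three_le_degree hv
      omega
    clear hR'
    generalize hex.choose = j at hj ⊢
    clear hex
    generalize hva : v + unitExp i = a at hj hdeg hdeg' ⊢
    refine vertices_related hI.toIsCubicUpperSet h1 h2 hdeg' (r := fun p q => F a p = F a q)
      ⟨fun _ => rfl, Eq.symm, Eq.trans⟩ ?_ hv hv' hva hj
    rintro p q w hw rfl
    by_cases hpq : p = q
    · rw [hpq]
    rw [map_add, map_add, Finsupp.degree_single, Finsupp.degree_single] at hdeg
    rw [hF, add_right_comm, hF, Submodule.mkQ_apply, Submodule.mkQ_apply, eq_comm,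
      Submodule.Quotient.eq]
    exact chain_sub_chain_mem_koszulBoundaries hI hw 1 hdeg hpq
  have hcoord (j : σ) : B.mkQ (chain {j} (c {j})) = Φ (X j * c {j}) := by
    rw [(c {j}).as_sum, chain_sum, Finset.mul_sum, map_sum, map_sum]
    refine Finset.sum_congr rfl fun u hu => ?_
    have hu0 := mem_support_iff.1 hu
    have huA := hI.mem_of_coeff (hc {j}).1 hu0
    have hue := (hc {j}).2.2 u hu0
    rw [← monomial_add_unitExp, hΦ, ← hR j u huA hue, ← map_smul, ← chain_smul, smul_monomial,
      smul_eq_mul, mul_one]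
  have hsum : c = ∑ j, chain {j} (c {j}) := by
    funext T
    rw [Finset.sum_apply]
    by_cases hT : T.card = 1
    · obtain ⟨j, rfl⟩ := Finset.card_eq_one.1 hT
      rw [Finset.sum_eq_single j, chain_same]
      · intro l _ hl
        exact chain_ne (by simpa using hl.symm) _
      · simp
    · rw [(hc T).2.1 hT, Finset.sum_eq_zero]
      intro l _
      refine chain_ne ?_ _
      rintro rfl
      exact hT (Finset.card_singleton l)
  have hzero : ∑ j, X j * c {j} = 0 := by
    rw [← koszulD_apply_empty, LinearMap.mem_ker.1 hcyc, Pi.zero_apply]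
  rw [← Submodule.Quotient.mk_eq_zero, ← Submodule.mkQ_apply]
  change B.mkQ c = 0
  rw [hsum, map_sum, Finset.sum_congr rfl fun j _ => hcoord j, ← map_sum, hzero, map_zero]

/-- An isolated vertex of the upper Koszul complex which is not the only vertex gives a nonzero
element of `Tor_1`. -/
theorem not_cycles_one_le_boundaries {I : Ideal (MvPolynomial σ k)} {A : Set (σ →₀ ℕ)}
    (hI : IsCubicMonomial I A) {v v' : σ →₀ ℕ} (hv : v ∈ A) (hv' : v' ∈ A) {i j : σ}
    (hij : i ≠ j) (hvv' : v + unitExp i = v' + unitExp j)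
    (hiso : ∀ l w, l ≠ i → w + unitExp l = v → w ∉ A) :
    ¬ koszulCycles I 1 (v.degree + 1) ≤ koszulBoundaries I 1 (v.degree + 1) := by
  intro hle
  have hdeg := congrArg Finsupp.degree hvv'
  rw [map_add, map_add, Finsupp.degree_single, Finsupp.degree_single] at hdeg
  have hmem : chain {i} (monomial v (1 : k)) - chain {j} (monomial v' 1) ∈
      koszulCycles I 1 (v.degree + 1) := by
    refine ⟨sub_mem (chain_mem_koszulChains hI hv 1 (Finset.card_singleton i) rfl)
      (chain_mem_koszulChains hI hv' 1 (Finset.card_singleton j) hdeg.symm), ?_⟩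
    rw [SetLike.mem_coe, LinearMap.mem_ker, map_sub, koszulD_chain_singleton,
      koszulD_chain_singleton, ← monomial_add_unitExp, ← monomial_add_unitExp, hvv', sub_self]
  obtain ⟨b, hb, hbe⟩ := hle hmem
  have h := congrArg (coeff v) (congrFun hbe {i})
  rw [Pi.sub_apply, chain_same, chain_ne (by simpa using hij), sub_zero, coeff_monomial,
    if_pos rfl, koszulD_apply, coeff_sum, Finset.sum_eq_zero] at h
  · exact zero_ne_one h
  -- A boundary can reach `x^v e_i` only through an edge at `i`, and there is none.
  intro l hl
  have hli : l ≠ i := by simpa using hl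
  have hz : coeff v (X l * b (insert l {i})) = 0 := by
    rw [coeff_X_mul']
    split_ifs with hlv
    · by_contra hne
      refine hiso l (v - unitExp l) hli (tsub_add_cancel_of_le ?_) (hI.mem_of_coeff (hb _).1 hne)
      rw [Finsupp.single_le_iff]
      exact Nat.one_le_iff_ne_zero.2 (Finsupp.mem_support_iff.1 hlv)
    · rfl
  rcases neg_one_pow_eq_or (MvPolynomial σ k) ((({i} : Finset σ).filter (· < l)).card) with h | h
  · rw [h, one_mul, hz]
  · rw [h, neg_one_mul, coeff_neg, hz, neg_zero]

end KoszulHomology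

/-! ### Linear presentation in terms of exponents -/

section Characterization

variable {σ k : Type*} [Field k]

theorem isLinearlyPresented_iff [Fintype σ] [LinearOrder σ] {I : Ideal (MvPolynomial σ k)}
    {A : Set (σ →₀ ℕ)} (hI : IsCubicMonomial I A)
    (hcube : ∀ i, unitExp i + unitExp i + unitExp i ∈ A) :
    IsLinearlyPresented 3 I ↔ ContainsNonSquareFree A ∧ FourVariableExchange A := by
  constructor
  · intro h
    have hlin {v v' : σ →₀ ℕ} {i j : σ} (hv : v ∈ A) (hv' : v' ∈ A) (hij : i ≠ j)
        (hvv' : v + unitExp i = v' + unitExp j)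
        (hiso : ∀ l w, l ≠ i → w + unitExp l = v → w ∉ A) : v.degree = 3 := by
      have := h 1 (by norm_num) (v.degree + 1) <| (nontrivial_gradedTor_iff I 1 _).2 <|
        not_cycles_one_le_boundaries hI hv hv' hij hvv' hiso
      omega
    have h1 : ContainsNonSquareFree A := by
      intro i j
      by_cases hij : i = j
      · rw [← hij]
        exact hcube i
      by_contra hiij
      by_cases hijj : unitExp i + unitExp j + unitExp j ∈ A
      -- In multidegree `x_i^3 x_j^2`, the edge `ij` would require `x_i^2 x_j` in `I`.
      · have := hlin (v := unitExp i + unitExp j + unitExp j + unitExp i)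
          (v' := unitExp i + unitExp i + unitExp i + unitExp j) (hI.upper le_self_add hijj)
          (hI.upper le_self_add (hcube i)) hij (by abel) ?_
        · simp at this
        intro l w hl hw hwA
        obtain rfl : l = j := by
          by_contra hlj
          have := DFunLike.congr_fun hw l
          simp [Ne.symm hl, Ne.symm hlj] at this
        refine hiij ?_
        convert hwA using 1
        refine add_right_cancel (b := unitExp l) ?_
        rw [hw]
        abel
      -- In multidegree `x_i^3 x_j^3`, the edge `ij` would require `x_i^2 x_j^2` in `I`, but both of
      -- its cubic divisors are missing.
      · have := hlin (v := unitExp j + unitExp j + unitExp j + (unitExp i + unitExp i))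
          (v' := unitExp i + unitExp i + unitExp i + (unitExp j + unitExp j))
          (hI.upper le_self_add (hcube j)) (hI.upper le_self_add (hcube i)) hij (by abel) ?_
        · simp at this
        intro l w hl hw hwA
        obtain rfl : l = j := by
          by_contra hlj
          have := DFunLike.congr_fun hw l
          simp [Ne.symm hl, Ne.symm hlj] at this
        obtain rfl : w = unitExp i + unitExp i + unitExp l + unitExp l := by
          refine add_right_cancel (b := unitExp l) ?_
          rw [hw]
          abel
        obtain ⟨t, ht, hle, htd⟩ := hI.exists_le _ hwA
        obtain ⟨u, hu⟩ := exists_add_of_le hle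
        have hud := congrArg Finsupp.degree hu
        simp only [map_add, Finsupp.degree_single, htd] at hud
        obtain ⟨p, rfl⟩ := exists_eq_of_degree_one (u := u) (by omega)
        by_cases hpi : p = i
        · subst hpi
          refine hijj ?_
          convert ht using 1
          refine add_right_cancel (b := unitExp p) ?_
          rw [← hu]
          abel
        by_cases hpl : p = l
        · subst hpl
          refine hiij ?_
          convert ht using 1
          exact add_right_cancel hu
        have := DFunLike.congr_fun hu p
        simp [Ne.symm hpi, Ne.symm hpl] at this
    refine ⟨h1, ?_⟩
    intro i j l m hij hil hjl hmi hmj hml hA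
    by_contra! hcon
    obtain ⟨h₁, h₂, h₃⟩ := hcon
    -- In multidegree `x_i x_j x_l x_m^2`, the vertex `m` is isolated: its edges would require one
    -- of the three missing cubics.
    have := hlin (v := unitExp i + unitExp j + unitExp l + unitExp m)
      (v' := unitExp m + unitExp m + unitExp j + unitExp l) (hI.upper le_self_add hA)
      (hI.upper le_self_add (h1 m j)) hmi (by abel) ?_
    · simp at this
    intro p w hp hw hwA
    by_cases hpi : p = i
    · subst hpi
      refine h₃ ?_
      convert hwA using 1
      refine add_right_cancel (b := unitExp p) ?_
      rw [hw]
      abel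
    by_cases hpj : p = j
    · subst hpj
      refine h₂ ?_
      convert hwA using 1
      refine add_right_cancel (b := unitExp p) ?_
      rw [hw]
      abel
    by_cases hpl : p = l
    · subst hpl
      refine h₁ ?_
      convert hwA using 1
      refine add_right_cancel (b := unitExp p) ?_
      rw [hw]
      abel
    have := DFunLike.congr_fun hw p
    simp [Ne.symm hp, Ne.symm hpi, Ne.symm hpj, Ne.symm hpl] at this
  · rintro ⟨h1, h2⟩ s hs e hnt
    rw [nontrivial_gradedTor_iff] at hnt
    by_contra he
    interval_cases s
    · exact hnt (cycles_zero_le_boundaries hI he)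
    · exact hnt (cycles_one_le_boundaries hI h1 h2 he)

theorem isCubicMonomial_exponents {I : Ideal (MvPolynomial σ k)} (hmon : IsMonomialIdeal I)
    (hgen : IsGeneratedInDegree 3 I) : IsCubicMonomial I {u | monomial u (1 : k) ∈ I} := by
  obtain ⟨M, hM⟩ := hmon
  have hupper : IsUpperSet {u | monomial u (1 : k) ∈ I} := by
    intro u v huv hu
    obtain ⟨w, rfl⟩ := exists_add_of_le huv
    rw [Set.mem_ofPred_eq, add_comm, ← one_mul (1 : k), ← monomial_mul]
    exact I.mul_mem_left _ hu
  have hmem : ∀ f, f ∈ I ↔ ∀ u ∈ f.support, u ∈ {u | monomial u (1 : k) ∈ I} := by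
    intro f
    constructor
    · intro hf u hu
      rw [hM, mem_ideal_span_monomial_image] at hf
      obtain ⟨v, hv, hvu⟩ := hf u hu
      refine hupper hvu ?_
      rw [Set.mem_ofPred_eq, hM]
      exact Ideal.subset_span ⟨v, hv, rfl⟩
    · intro hf
      rw [f.as_sum]
      refine I.sum_mem fun u hu => ?_
      rw [← mul_one (coeff u f), ← C_mul_monomial]
      exact I.mul_mem_left _ (hf u hu)
  refine ⟨⟨hupper, fun u hu => ?_⟩, hmem⟩
  let N : Set (σ →₀ ℕ) := {v | monomial v (1 : k) ∈ I ∧ v.degree = 3}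
  -- All monomials of a cubic form in `I` lie in `I`, so the cubic monomials of `I` generate it.
  have hle : I ≤ Ideal.span ((fun a => monomial a (1 : k)) '' N) := by
    conv_lhs => rw [hgen]
    rw [Ideal.span_le]
    rintro f ⟨hf, hf3⟩
    rw [SetLike.mem_coe, mem_ideal_span_monomial_image]
    intro v hv
    refine ⟨v, ⟨(hmem f).1 hf v hv, ?_⟩, le_rfl⟩
    rw [Finsupp.degree_eq_weight_one]
    exact hf3 (mem_support_iff.1 hv)
  obtain ⟨v, hv, hvu⟩ := mem_ideal_span_monomial_image.1 (hle hu) u (by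
    classical rw [mem_support_iff, coeff_monomial, if_pos rfl]; exact one_ne_zero)
  exact ⟨v, hv.1, hvu, hv.2⟩

/-- Some power of `x_i` lies in `I`, and its only cubic divisor is `x_i^3`. -/
theorem cube_mem_exponents {I : Ideal (MvPolynomial σ k)} {A : Set (σ →₀ ℕ)}
    (hI : IsCubicMonomial I A) (hprim : IsMaxPrimary I) (i : σ) :
    unitExp i + unitExp i + unitExp i ∈ A := by
  have hX : (X i : MvPolynomial σ k) ∈ I.radical := by
    rw [hprim.2]
    exact Ideal.subset_span ⟨i, rfl⟩
  obtain ⟨N, hN⟩ := hX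
  rw [X_pow_eq_monomial] at hN
  obtain ⟨v, hv, hle, hd⟩ := hI.exists_le _ (hI.mem_of_monomial_mem hN)
  convert hv using 1
  have hvs : v = Finsupp.single i (v i) := by
    ext j
    by_cases hj : i = j
    · simp [hj]
    · have := hle j
      simpa [Finsupp.single_apply, hj] using this
  rw [hvs, Finsupp.degree_single] at hd
  rw [hvs, hd, ← Finsupp.single_add, ← Finsupp.single_add]

theorem maxIdealBracket_mul_maxIdeal_le_iff {I : Ideal (MvPolynomial σ k)} {A : Set (σ →₀ ℕ)}
    (hI : IsCubicMonomial I A) :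
    maxIdealBracket σ k 2 * maxIdeal σ k ≤ I ↔ ContainsNonSquareFree A := by
  classical
  have hmon (i j : σ) : (X i ^ 2 * X j : MvPolynomial σ k) =
      monomial (unitExp i + unitExp i + unitExp j) 1 := by
    rw [pow_two, X, X, monomial_mul, monomial_mul, one_mul, one_mul]
  rw [maxIdealBracket, maxIdeal, Ideal.span_mul_span', Ideal.span_le]
  constructor
  · intro h i j
    have := h (Set.mul_mem_mul (Set.mem_range_self i) (Set.mem_range_self j))
    simp only [hmon] at this
    exact hI.mem_of_monomial_mem this
  · rintro h _ ⟨_, ⟨i, rfl⟩, _, ⟨j, rfl⟩, rfl⟩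
    simp only [hmon]
    exact hI.monomial_mem (h i j) 1

theorem mem_squareFreeCubics_iff {I : Ideal (MvPolynomial σ k)} {A : Set (σ →₀ ℕ)}
    (hI : IsCubicMonomial I A) (f : MvPolynomial σ k) :
    f ∈ squareFreeCubics I ↔ ∃ i j l, i ≠ j ∧ i ≠ l ∧ j ≠ l ∧
      unitExp i + unitExp j + unitExp l ∈ A ∧
      f = monomial (unitExp i + unitExp j + unitExp l) 1 := by
  classical
  have hprod {i j l : σ} (hij : i ≠ j) (hil : i ≠ l) (hjl : j ≠ l) :
      (∏ p ∈ {i, j, l}, X p : MvPolynomial σ k) =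
        monomial (unitExp i + unitExp j + unitExp l) 1 := by
    rw [Finset.prod_insert (by simp [hij, hil]), Finset.prod_pair hjl, ← mul_assoc, X, X, X,
      monomial_mul, monomial_mul, one_mul, one_mul]
  constructor
  · rintro ⟨hf, T, hT, rfl⟩
    obtain ⟨i, j, l, hij, hil, hjl, rfl⟩ := Finset.card_eq_three.1 hT
    rw [hprod hij hil hjl] at hf ⊢
    exact ⟨i, j, l, hij, hil, hjl, hI.mem_of_monomial_mem hf, rfl⟩
  · rintro ⟨i, j, l, hij, hil, hjl, hA, rfl⟩
    exact ⟨hI.monomial_mem hA 1, {i, j, l}, Finset.card_eq_three.2 ⟨i, j, l, hij, hil, hjl, rfl⟩,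
      (hprod hij hil hjl).symm⟩

/-! ### Restriction to a subset of the variables -/

/-- The exponents in `A` of the monomials in the variables of `K`. -/
def restrictExponents (A : Set (σ →₀ ℕ)) (K : Finset σ) : Set (K →₀ ℕ) :=
  Finsupp.mapDomain Subtype.val ⁻¹' A

theorem mem_restrictExponents_add (A : Set (σ →₀ ℕ)) (K : Finset σ) (i j l : K) :
    unitExp i + unitExp j + unitExp l ∈ restrictExponents A K ↔
      unitExp (i : σ) + unitExp (j : σ) + unitExp (l : σ) ∈ A := by
  simp [restrictExponents, Finsupp.mapDomain_add, Finsupp.mapDomain_single]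

theorem isCubicMonomial_restrict {I : Ideal (MvPolynomial σ k)} {A : Set (σ →₀ ℕ)}
    (hI : IsCubicMonomial I A) (K : Finset σ) :
    IsCubicMonomial (restrict I K) (restrictExponents A K) := by
  classical
  have hinj : Function.Injective (Subtype.val : K → σ) := Subtype.val_injective
  have hsurj : Function.Surjective (killCompl (R := k) hinj) :=
    fun f => ⟨rename Subtype.val f, killCompl_rename_app hinj f⟩
  refine ⟨⟨fun u v huv hu => ?_, fun u hu => ?_⟩, fun f => ⟨fun hf u hu => ?_, fun hf => ?_⟩⟩
  · obtain ⟨w, rfl⟩ := exists_add_of_le huv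
    rw [restrictExponents, Set.mem_preimage, Finsupp.mapDomain_add]
    exact hI.upper le_self_add hu
  · obtain ⟨v, hv, hle, hd⟩ := hI.exists_le _ hu
    -- A divisor of a monomial in the variables of `K` involves only these variables.
    have hsub : (v.support : Set σ) ⊆ Set.range (Subtype.val : K → σ) := by
      intro x hx
      have h1 : x ∈ (Finsupp.mapDomain Subtype.val u).support := by
        rw [Finsupp.mem_support_iff]
        have h2 := hle x
        have h3 := Finsupp.mem_support_iff.1 (Finset.mem_coe.1 hx)
        omega
      obtain ⟨y, -, rfl⟩ := Finset.mem_image.1 (Finsupp.mapDomain_support h1)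
      exact ⟨y, rfl⟩
    have hmap := v.mapDomain_comapDomain Subtype.val hinj hsub
    refine ⟨v.comapDomain Subtype.val hinj.injOn, ?_, fun x => ?_, ?_⟩
    · rw [restrictExponents, Set.mem_preimage, hmap]
      exact hv
    · have := hle x
      rwa [Finsupp.mapDomain_apply hinj] at this
    · rw [← Finsupp.degree_mapDomain Subtype.val, hmap, hd]
  · obtain ⟨g, hg, rfl⟩ := (Ideal.mem_map_iff_of_surjective _ hsurj).1 hf
    rw [mem_support_iff, coeff_killCompl] at hu
    exact hI.mem_of_coeff hg hu
  · rw [← killCompl_rename_app hinj f]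
    refine Ideal.mem_map_of_mem _ ((hI.mem_iff _).2 fun u hu => ?_)
    rw [support_rename_of_injective hinj] at hu
    obtain ⟨v, hv, rfl⟩ := Finset.mem_image.1 hu
    exact hf v hv

theorem ContainsNonSquareFree.restrict {A : Set (σ →₀ ℕ)} (h : ContainsNonSquareFree A)
    (K : Finset σ) : ContainsNonSquareFree (restrictExponents A K) :=
  fun i j => (mem_restrictExponents_add A K i i j).2 (h i j)

theorem FourVariableExchange.restrict {A : Set (σ →₀ ℕ)} (h : FourVariableExchange A)
    (K : Finset σ) : FourVariableExchange (restrictExponents A K) := by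
  intro i j l m hij hil hjl hmi hmj hml hA
  simp only [mem_restrictExponents_add] at hA ⊢
  exact h i j l m (Subtype.coe_injective.ne hij) (Subtype.coe_injective.ne hil)
    (Subtype.coe_injective.ne hjl) (Subtype.coe_injective.ne hmi)
    (Subtype.coe_injective.ne hmj) (Subtype.coe_injective.ne hml) hA

theorem FourVariableExchange.of_restrict {A : Set (σ →₀ ℕ)}
    (h : ∀ K : Finset σ, K.card = 4 → FourVariableExchange (restrictExponents A K)) :
    FourVariableExchange A := by
  classical
  intro i j l m hij hil hjl hmi hmj hml hA
  have hK : ({i, j, l, m} : Finset σ).card = 4 := by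
    rw [Finset.card_insert_of_notMem (by simp [hij, hil, hmi.symm]),
      Finset.card_eq_three.2 ⟨j, l, m, hjl, hmj.symm, hml.symm, rfl⟩]
  have := h {i, j, l, m} hK ⟨i, by simp⟩ ⟨j, by simp⟩ ⟨l, by simp⟩ ⟨m, by simp⟩
    (by simpa using hij) (by simpa using hil) (by simpa using hjl) (by simpa using hmi)
    (by simpa using hmj) (by simpa using hml)
  simp only [mem_restrictExponents_add] at this
  exact this hA

/-- In four variables, the exchange condition says that there are no square-free cubics or at
least two. -/
theorem fourVariableExchange_iff_encard [Fintype σ] (hσ : Fintype.card σ = 4)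
    {I : Ideal (MvPolynomial σ k)} {A : Set (σ →₀ ℕ)} (hI : IsCubicMonomial I A) :
    FourVariableExchange A ↔
      2 ≤ (squareFreeCubics I).encard ∨ squareFreeCubics I = ∅ := by
  classical
  have hfourth (i j l : σ) : ∃ m, m ≠ i ∧ m ≠ j ∧ m ≠ l := by
    by_contra! hall
    have hsub : (Finset.univ : Finset σ) ⊆ {i, j, l} := by
      intro x _
      have := hall x
      simp only [Finset.mem_insert, Finset.mem_singleton]
      tauto
    have := (Finset.card_le_card hsub).trans Finset.card_le_three
    rw [Finset.card_univ, hσ] at this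
    omega
  have huniv {i j l m : σ} (hij : i ≠ j) (hil : i ≠ l) (hjl : j ≠ l) (hmi : m ≠ i)
      (hmj : m ≠ j) (hml : m ≠ l) : ({m, i, j, l} : Finset σ) = Finset.univ := by
    refine Finset.eq_univ_of_card _ ?_
    rw [hσ, Finset.card_insert_of_notMem (by simp [hmi, hmj, hml]),
      Finset.card_eq_three.2 ⟨i, j, l, hij, hil, hjl, rfl⟩]
  have hsum {i j l m : σ} (hij : i ≠ j) (hil : i ≠ l) (hjl : j ≠ l) (hmi : m ≠ i)
      (hmj : m ≠ j) (hml : m ≠ l) :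
      ∑ p, unitExp p = unitExp i + unitExp j + unitExp l + unitExp m := by
    rw [← huniv hij hil hjl hmi hmj hml, Finset.sum_insert (by simp [hmi, hmj, hml]),
      Finset.sum_insert (by simp [hij, hil]), Finset.sum_pair hjl]
    abel
  have hmem {i j l : σ} (hij : i ≠ j) (hil : i ≠ l) (hjl : j ≠ l)
      (h : unitExp i + unitExp j + unitExp l ∈ A) :
      monomial (unitExp i + unitExp j + unitExp l) (1 : k) ∈ squareFreeCubics I :=
    (mem_squareFreeCubics_iff hI _).2 ⟨i, j, l, hij, hil, hjl, h, rfl⟩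
  have hne {u v : σ →₀ ℕ} (p : σ) (h : u p ≠ v p) :
      monomial u (1 : k) ≠ monomial v 1 := fun he =>
    h (by rw [monomial_left_injective one_ne_zero he])
  rw [show (2 : ℕ∞) = 1 + 1 by norm_num, ENat.add_one_le_iff (by simp), Set.one_lt_encard_iff]
  constructor
  · intro h
    refine or_iff_not_imp_right.2 fun hnonempty => ?_
    obtain ⟨f, hf⟩ := Set.nonempty_iff_ne_empty.2 hnonempty
    obtain ⟨i, j, l, hij, hil, hjl, hA, rfl⟩ := (mem_squareFreeCubics_iff hI f).1 hf
    obtain ⟨m, hmi, hmj, hml⟩ := hfourth i j l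
    rcases h i j l m hij hil hjl hmi hmj hml hA with h | h | h
    · refine ⟨_, _, hf, hmem hij (Ne.symm hmi) (Ne.symm hmj) h, hne m ?_⟩
      simp [Ne.symm hmi, Ne.symm hmj, Ne.symm hml]
    · refine ⟨_, _, hf, hmem hil (Ne.symm hmi) (Ne.symm hml) h, hne m ?_⟩
      simp [Ne.symm hmi, Ne.symm hmj, Ne.symm hml]
    · refine ⟨_, _, hf, hmem hjl (Ne.symm hmj) (Ne.symm hml) h, hne m ?_⟩
      simp [Ne.symm hmi, Ne.symm hmj, Ne.symm hml]
  · intro h i j l m hij hil hjl hmi hmj hml hA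
    obtain ⟨f, hf, hfne⟩ : ∃ f ∈ squareFreeCubics I,
        f ≠ monomial (unitExp i + unitExp j + unitExp l) 1 := by
      have hnonempty := Set.nonempty_iff_ne_empty.1 ⟨_, hmem hij hil hjl hA⟩
      obtain ⟨f, g, hf, hg, hfg⟩ := h.resolve_right hnonempty
      by_cases hfe : f = monomial (unitExp i + unitExp j + unitExp l) 1
      · exact ⟨g, hg, fun hge => hfg (hfe.trans hge.symm)⟩
      · exact ⟨f, hf, hfe⟩
    obtain ⟨p, q, r, hpq, hpr, hqr, hpA, rfl⟩ := (mem_squareFreeCubics_iff hI f).1 hf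
    obtain ⟨x, hxp, hxq, hxr⟩ := hfourth p q r
    -- In four variables a square-free cubic is determined by the variable it omits, so the second
    -- cubic omits `i`, `j` or `l`.
    have hs := (hsum hpq hpr hqr hxp hxq hxr).symm.trans (hsum hij hil hjl hmi hmj hml)
    have hx : x ∈ ({m, i, j, l} : Finset σ) := by
      rw [huniv hij hil hjl hmi hmj hml]
      exact Finset.mem_univ x
    simp only [Finset.mem_insert, Finset.mem_singleton] at hx
    rcases hx with rfl | rfl | rfl | rfl
    · exact absurd (by rw [add_right_cancel hs]) hfne
    · refine .inr (.inr ?_)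
      convert hpA using 1
      refine add_right_cancel (b := unitExp x) ?_
      rw [hs]
      abel
    · refine .inr (.inl ?_)
      convert hpA using 1
      refine add_right_cancel (b := unitExp x) ?_
      rw [hs]
      abel
    · refine .inl ?_
      convert hpA using 1
      refine add_right_cancel (b := unitExp x) ?_
      rw [hs]
      abel

end Characterization

end LinPres

theorem theorem2p4 {k : Type*} [Field k] (n : ℕ) (I : Ideal (MvPolynomial (Fin n) k))
    (hprim : LinPres.IsMaxPrimary I) (hmon : LinPres.IsMonomialIdeal I)
    (hgen : LinPres.IsGeneratedInDegree 3 I) :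
    (LinPres.IsLinearlyPresented 3 I ↔
      LinPres.maxIdealBracket (Fin n) k 2 * LinPres.maxIdeal (Fin n) k ≤ I ∧
      ∀ K : Finset (Fin n), K.card = 4 →
        2 ≤ (LinPres.squareFreeCubics (LinPres.restrict I K)).encard ∨
        LinPres.squareFreeCubics (LinPres.restrict I K) = ∅) ∧
    (LinPres.IsLinearlyPresented 3 I ↔
      ∀ K : Finset (Fin n), K.card ≤ 4 →
        LinPres.IsLinearlyPresented 3 (LinPres.restrict I K)) ∧
    (4 ≤ n →
      (LinPres.IsLinearlyPresented 3 I ↔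
        ∀ K : Finset (Fin n), K.card = 4 →
          LinPres.IsLinearlyPresented 3 (LinPres.restrict I K))) := by
  have hI := LinPres.isCubicMonomial_exponents hmon hgen
  have hcube := LinPres.cube_mem_exponents hI hprim
  generalize {u | MvPolynomial.monomial u (1 : k) ∈ I} = A at hI hcube
  have hIK (K : Finset (Fin n)) := LinPres.isLinearlyPresented_iff
    (LinPres.isCubicMonomial_restrict hI K)
    fun i => (LinPres.mem_restrictExponents_add A K i i i).2 (hcube i)
  rw [LinPres.isLinearlyPresented_iff hI hcube, LinPres.maxIdealBracket_mul_maxIdeal_le_iff hI]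
  simp only [hIK]
  refine ⟨and_congr_right fun _ => ?_, ⟨fun h K _ => ⟨h.1.restrict K, h.2.restrict K⟩, fun h => ?_⟩,
    fun hn => ⟨fun h K _ => ⟨h.1.restrict K, h.2.restrict K⟩, fun h => ?_⟩⟩
  · have hiff (K : Finset (Fin n)) (hK : K.card = 4) :=
      LinPres.fourVariableExchange_iff_encard (by rw [Fintype.card_coe, hK])
        (LinPres.isCubicMonomial_restrict hI K)
    exact ⟨fun h K hK => (hiff K hK).1 (h.restrict K),
      fun h => .of_restrict fun K hK => (hiff K hK).2 (h K hK)⟩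
  · refine ⟨fun i j => ?_, .of_restrict fun K hK => (h K hK.le).2⟩
    have := (h {i, j} (Finset.card_le_two.trans (by norm_num))).1 ⟨i, by simp⟩ ⟨j, by simp⟩
    rwa [LinPres.mem_restrictExponents_add] at this
  · refine ⟨fun i j => ?_, .of_restrict fun K hK => (h K hK).2⟩
    -- The bound `4 ≤ n` serves to enlarge `{i, j}` to four variables.
    obtain ⟨K, hijK, hK⟩ := Finset.exists_superset_card_eq (s := {i, j}) (n := 4)
      (Finset.card_le_two.trans (by norm_num)) (by rwa [Fintype.card_fin])
    have := (h K hK).1 ⟨i, hijK (by simp)⟩ ⟨j, hijK (by simp)⟩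
    rwa [LinPres.mem_restrictExponents_add] at this
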